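/- **Normality theorem (Montel's big theorem).** Let $a,b\in\mathbb{C}$ with $a\neq b$, let $\Omega\subseteq\mathbb{C}$ be a domain (a nonempty connected open set), and let $\mathscr{F}$ be any family of holomorphic maps $\Omega\to\mathbb{C}\setminus\{a,b\}$. Then $\mathscr{F}$ is normal, in the following sense: for every sequence $(f_n)_{n\in\mathbb{N}}$ in $\mathscr{F}$, either 1. some subsequence $(f_{n_k})_k$ converges, uniformly on every compact subset of $\Omega$, to a holomorphic map $g\colon\Omega\to\mathbb{C}\setminus\{a,b\}$; or 2. the sequence $(f_n)$ is compactly divergent: for all compact sets $K\subset\Omega$ and $L\subset\mathbb{C}\setminus\{a,b\}$ there is $N\in\mathbb{N}$ such that $f_n(K)\cap L=\varnothing$ for all $n>N$. (Since all sequences in $\mathscr{F}$ are considered, this is equivalent to: every sequence in $\mathscr{F}$ has a subsequence that either converges uniformly on compact subsets of $\Omega$ to a holomorphic map $\Omega\to\mathbb{C}\setminus\{a,b\}$ or is compactly divergent.) -/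

import Mathlib

open Set Filter Topology

/-- Holomorphic maps from the open set `Ω₁` to `Ω₂`. A map is represented by a function on `ℂ`;
only its values on `Ω₁` matter. -/
def HolMaps (Ω₁ Ω₂ : Set ℂ) : Set (ℂ → ℂ) :=
  {f | DifferentiableOn ℂ f Ω₁ ∧ MapsTo f Ω₁ Ω₂}

/-- `f n → g` uniformly on every compact subset of `Ω`. -/
def ConvergesOnCompacts (Ω : Set ℂ) (f : ℕ → ℂ → ℂ) (g : ℂ → ℂ) : Prop :=
  ∀ K : Set ℂ, IsCompact K → K ⊆ Ω → TendstoUniformlyOn f g atTop K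

/-- Compact divergence of a sequence of maps `Ω₁ → Ω₂`. -/
def CompactlyDivergent (Ω₁ Ω₂ : Set ℂ) (f : ℕ → ℂ → ℂ) : Prop :=
  ∀ K L : Set ℂ, IsCompact K → K ⊆ Ω₁ → IsCompact L → L ⊆ Ω₂ →
    ∃ N : ℕ, ∀ n > N, (f n '' K) ∩ L = ∅

/-- Normality of a family of holomorphic maps `Ω₁ → Ω₂`: every sequence in the family has a
subsequence converging, uniformly on compact sets, to a holomorphic map `Ω₁ → Ω₂`, or the
sequence is compactly divergent. -/
def IsNormalFamily (Ω₁ Ω₂ : Set ℂ) (F : Set (ℂ → ℂ)) : Prop :=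
  ∀ f : ℕ → ℂ → ℂ, (∀ n, f n ∈ F) →
    (∃ φ : ℕ → ℕ, StrictMono φ ∧
      ∃ g ∈ HolMaps Ω₁ Ω₂, ConvergesOnCompacts Ω₁ (fun n => f (φ n)) g) ∨
    CompactlyDivergent Ω₁ Ω₂ f

/-! If the sequence is not compactly divergent, infinitely many of its terms send points of one
compact `K` into one compact `L`, and such points accumulate at some `z₀`. Schottky's theorem turns
the bound on `L` into a bound at `z₀`, and connectedness spreads it to local boundedness on `Ω`.
Montel's theorem extracts a limit `g`. Since `g z₀ ∈ L`, `g` is constantly equal to neither `a` nor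
`b`, so by Hurwitz's theorem it omits both.

Schottky's theorem rests on Bloch's. With the omitted values normalised to `±1`, write `f = cos (π
cos G)`. Then `G` omits a net meeting every disc of radius 4, so Bloch's theorem bounds `G'` and
hence the growth of `G`. -/

/-! ### Bloch's theorem -/

open Metric in
/-- A quantitative open mapping theorem: if `|f'|` is at most twice its value at the centre of a
disc, then the image of the disc contains a disc of comparable size. -/
theorem exists_ball_subset_image_of_norm_deriv_le_two_mul {f : ℂ → ℂ} {c : ℂ} {t : ℝ} (ht : 0 < t)
    (hf : DifferentiableOn ℂ f (ball c t)) (hc : deriv f c ≠ 0)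
    (hb : ∀ z ∈ ball c t, ‖deriv f z‖ ≤ 2 * ‖deriv f c‖) :
    ball (f c) (‖deriv f c‖ * t / 32) ⊆ f '' ball c t := by
  set m := ‖deriv f c‖ with hm
  have hm0 : 0 < m := norm_pos_iff.2 hc
  have hcb : closedBall c (t / 8) ⊆ ball c t := closedBall_subset_ball (by linarith)
  have hdiff : ∀ z ∈ ball c t, DifferentiableAt ℂ f z := fun z hz =>
    hf.differentiableAt (isOpen_ball.mem_nhds hz)
  have hd' : DifferentiableOn ℂ (deriv f) (ball c t) := hf.deriv isOpen_ball
  have hmaps : MapsTo (deriv f) (ball c t) (closedBall (deriv f c) (3 * m)) := by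
    intro z hz
    rw [mem_closedBall, dist_eq_norm]
    have := hb z hz
    have := norm_sub_le (deriv f z) (deriv f c)
    linarith
  -- Schwarz's lemma applied to `deriv f`.
  have hderiv : ∀ z ∈ closedBall c (t / 8), ‖deriv f z - deriv f c‖ ≤ 3 / 8 * m := by
    intro z hz
    have h := Complex.dist_le_div_mul_dist_of_mapsTo_ball hd' hmaps (hcb hz)
    rw [dist_eq_norm] at h
    refine h.trans ?_
    have : dist z c ≤ t / 8 := hz
    calc 3 * m / t * dist z c ≤ 3 * m / t * (t / 8) := by gcongr
      _ = 3 / 8 * m := by field_simp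
  -- The linear part has size `m t / 8` on this circle and the remainder is `3 m / 8`-Lipschitz,
  -- leaving `5 m t / 64`.
  have hlow : ∀ z ∈ sphere c (t / 8), m * t / 16 ≤ ‖f z - f c‖ := by
    intro z hz
    have hz' : z ∈ closedBall c (t / 8) := sphere_subset_closedBall hz
    have key := (convex_closedBall c (t / 8)).norm_image_sub_le_of_norm_hasDerivWithin_le
      (f := fun z => f z - deriv f c * z) (f' := fun z => deriv f z - deriv f c)
      (C := 3 / 8 * m) (fun x hx => (((hdiff x (hcb hx)).hasDerivAt).sub
        (by simpa using (hasDerivAt_id x).const_mul (deriv f c))).hasDerivWithinAt) hderiv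
      (mem_closedBall_self (by positivity)) hz'
    have hn : ‖z - c‖ = t / 8 := by rw [← dist_eq_norm]; exact hz
    have h2 : ‖deriv f c * (z - c)‖ = m * (t / 8) := by rw [norm_mul, hn]
    have h3 : deriv f c * (z - c) = (f z - f c) -
      ((f z - deriv f c * z) - (f c - deriv f c * c)) := by ring
    have h4 := norm_sub_le (f z - f c) ((f z - deriv f c * z) - (f c - deriv f c * c))
    rw [← h3, h2] at h4
    rw [hn] at key
    nlinarith [mul_pos hm0 ht]
  have hfreq : ∃ᶠ z in 𝓝 c, f z ≠ f c := by
    intro hev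
    have hev : f =ᶠ[𝓝 c] fun _ => f c := by
      filter_upwards [hev] with z hz using not_not.1 hz
    exact hc (by rw [hev.deriv_eq]; simp)
  have hdc : DiffContOnCl ℂ f (ball c (t / 8)) :=
    (hf.mono (closure_ball_subset_closedBall.trans hcb)).diffContOnCl
  have := hdc.ball_subset_image_closedBall (by positivity) hlow hfreq
  refine Subset.trans ?_ (this.trans (image_mono hcb))
  exact ball_subset_ball (by linarith)

open Metric in
/-- **Bloch's theorem** (with a non-optimal constant): a holomorphic function on a disc of radius
`r` whose image contains no disc of radius `B` has derivative at most `128 B / r` at the centre. -/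
theorem norm_deriv_mul_le_of_forall_not_ball_subset_image {f : ℂ → ℂ} {c : ℂ} {r B : ℝ}
    (hr : 0 < r) (hB : 0 < B) (hf : DifferentiableOn ℂ f (ball c r))
    (h : ∀ w, ¬ ball w B ⊆ f '' ball c r) : ‖deriv f c‖ * r ≤ 128 * B := by
  by_contra! hlt
  have hsub : closedBall c (r / 2) ⊆ ball c r := closedBall_subset_ball (by linarith)
  have hd' : DifferentiableOn ℂ (deriv f) (ball c r) := hf.deriv isOpen_ball
  -- Landau's trick: where this weighted derivative is maximal, `|f'|` at most doubles within half
  -- the distance to the boundary of the disc.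
  have hcont : ContinuousOn (fun z => ‖deriv f z‖ * (r / 2 - dist z c)) (closedBall c (r / 2)) :=
    ((hd'.continuousOn.mono hsub).norm).mul (by fun_prop)
  obtain ⟨p, hp, hmax⟩ := (isCompact_closedBall c (r / 2)).exists_isMaxOn
    ⟨c, mem_closedBall_self (by positivity)⟩ hcont
  have hpc : ‖deriv f c‖ * (r / 2) ≤ ‖deriv f p‖ * (r / 2 - dist p c) := by
    simpa using hmax (mem_closedBall_self (by positivity : (0:ℝ) ≤ r / 2))
  have hpd : dist p c ≤ r / 2 := hp
  have hV : 0 < ‖deriv f p‖ * (r / 2 - dist p c) := by linarith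
  have hp0 : 0 < ‖deriv f p‖ := pos_of_mul_pos_left hV (by linarith)
  have hs : 0 < r / 2 - dist p c := pos_of_mul_pos_right hV hp0.le
  set t := (r / 2 - dist p c) / 2 with ht
  have ht0 : 0 < t := by positivity
  have hdist : ∀ z ∈ ball p t, t ≤ r / 2 - dist z c := by
    intro z hz
    have := dist_triangle z p c
    have : dist z p < t := hz
    linarith
  have hbs : ball p t ⊆ closedBall c (r / 2) := fun z hz => by
    rw [mem_closedBall]; linarith [hdist z hz]
  have hsub2 := exists_ball_subset_image_of_norm_deriv_le_two_mul ht0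
    (hf.mono (hbs.trans hsub)) (norm_pos_iff.1 hp0) (fun z hz => by
      have h1 : ‖deriv f z‖ * (r / 2 - dist z c) ≤ ‖deriv f p‖ * (r / 2 - dist p c) :=
        hmax (hbs hz)
      have h2 := mul_le_mul_of_nonneg_left (hdist z hz) (norm_nonneg (deriv f z))
      have h3 : r / 2 - dist p c = 2 * t := by rw [ht]; ring
      rw [h3] at h1
      nlinarith)
  refine h (f p) ((ball_subset_ball ?_).trans (hsub2.trans (image_mono (hbs.trans hsub))))
  have h3 : r / 2 - dist p c = 2 * t := by rw [ht]; ring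
  rw [h3] at hpc
  linarith

/-! ### Holomorphic logarithms and inverse cosines -/

open Metric in
/-- A nonvanishing holomorphic function on a disc has a holomorphic logarithm. -/
theorem exists_differentiableOn_exp_eq {f : ℂ → ℂ} {c : ℂ} {r : ℝ}
    (hf : DifferentiableOn ℂ f (ball c r)) (h0 : ∀ z ∈ ball c r, f z ≠ 0) :
    ∃ g : ℂ → ℂ, DifferentiableOn ℂ g (ball c r) ∧ ∀ z ∈ ball c r, Complex.exp (g z) = f z := by
  rcases le_or_gt r 0 with hr | hr
  · exact ⟨0, by simp [ball_eq_empty.2 hr], by simp [ball_eq_empty.2 hr]⟩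
  -- `P` is a primitive of `f' / f`, so `f * exp (-P)` is constant.
  obtain ⟨P, hP⟩ := (hf.deriv isOpen_ball |>.div hf h0).isExactOn_ball
  have hcc : c ∈ ball c r := mem_ball_self hr
  have hconst : ∀ z ∈ ball c r, f z * Complex.exp (-P z) = f c * Complex.exp (-P c) := by
    intro z hz
    have hD : ∀ x ∈ ball c r, HasDerivAt (fun z => f z * Complex.exp (-P z)) 0 x := by
      intro x hx
      have h1 := (hf.differentiableAt (isOpen_ball.mem_nhds hx)).hasDerivAt
      have h2 := (hP x hx).neg.cexp
      refine (h1.mul h2).congr_deriv ?_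
      have := h0 x hx
      simp only [Pi.div_apply, Pi.neg_apply]
      field_simp
      ring
    exact (convex_ball c r).is_const_of_fderivWithin_eq_zero (𝕜 := ℂ)
      (fun x hx => (hD x hx).differentiableAt.differentiableWithinAt)
      (fun x hx => by
        have := ((hD x hx).hasFDerivAt.hasFDerivWithinAt (s := ball c r)).fderivWithin
          (isOpen_ball.uniqueDiffWithinAt hx)
        rw [this]; ext; simp) hz hcc
  refine ⟨fun z => P z + (Complex.log (f c) - P c), fun z hz =>
    ((hP z hz).differentiableAt.add_const _).differentiableWithinAt, fun z hz => ?_⟩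
  have h1 := hconst z hz
  rw [Complex.exp_add, Complex.exp_sub, Complex.exp_log (h0 c hcc)]
  rw [Complex.exp_neg, Complex.exp_neg] at h1
  field_simp at h1 ⊢
  linear_combination -h1

/-- Every complex number has an inverse cosine of controlled size. -/
theorem exists_cos_eq_and_norm_le (w : ℂ) : ∃ v : ℂ, Complex.cos v = w ∧ ‖v‖ ≤ Real.pi + ‖w‖ := by
  obtain ⟨u, hu⟩ := Complex.cos_surjective w
  obtain ⟨n, hn, -⟩ := existsUnique_sub_zsmul_mem_Ico Real.two_pi_pos u.re (-Real.pi)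
  refine ⟨u - n * (2 * Real.pi), ?_, ?_⟩
  · rw [Complex.cos_sub_int_mul_two_pi, hu]
  set v : ℂ := u - n * (2 * Real.pi) with hv
  have hcv : Complex.cos v = w := by rw [Complex.cos_sub_int_mul_two_pi, hu]
  have hre : |v.re| ≤ Real.pi := by
    have : v.re = u.re - n • (2 * Real.pi) := by simp [hv]
    rw [this, abs_le]
    constructor <;> linarith [hn.1, hn.2]
  have him : |v.im| ≤ ‖w‖ := by
    have h1 : ‖w‖ ^ 2 = Real.cos v.re ^ 2 + Real.sinh v.im ^ 2 := by
      rw [← hcv, Complex.cos_eq, ← Complex.normSq_eq_norm_sq, Complex.normSq_apply]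
      simp only [← Complex.ofReal_cos, ← Complex.ofReal_sin, ← Complex.ofReal_cosh,
        ← Complex.ofReal_sinh, ← Complex.ofReal_mul]
      simp only [Complex.sub_re, Complex.sub_im, Complex.mul_re, Complex.mul_im, Complex.ofReal_re,
        Complex.ofReal_im, Complex.I_re, Complex.I_im]
      have h1 := Real.cosh_sq v.im
      have h2 := Real.sin_sq_add_cos_sq v.re
      linear_combination Real.cos v.re ^ 2 * h1 + Real.sinh v.im ^ 2 * h2
    have h2 : |v.im| ≤ |Real.sinh v.im| := by
      rcases le_total 0 v.im with h | h
      · rw [abs_of_nonneg h]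
        exact (Real.self_le_sinh_iff.2 h).trans (le_abs_self _)
      · rw [abs_of_nonpos h]
        have := Real.sinh_le_self_iff.2 h
        exact (neg_le_neg this).trans (neg_le_abs _)
    refine h2.trans (abs_le_of_sq_le_sq ?_ (norm_nonneg _))
    nlinarith [sq_nonneg (Real.cos v.re)]
  exact (Complex.norm_le_abs_re_add_abs_im v).trans (add_le_add hre him)

theorem Complex.norm_cos_le_exp_norm (z : ℂ) : ‖Complex.cos z‖ ≤ Real.exp ‖z‖ := by
  have h1 : ‖Complex.exp (z * Complex.I)‖ ≤ Real.exp ‖z‖ := by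
    simpa using Complex.norm_exp_le_exp_norm (z * Complex.I)
  have h2 : ‖Complex.exp (-z * Complex.I)‖ ≤ Real.exp ‖z‖ := by
    simpa using Complex.norm_exp_le_exp_norm (-z * Complex.I)
  rw [Complex.cos, norm_div, Complex.norm_ofNat, div_le_iff₀ (by norm_num)]
  linarith [norm_add_le (Complex.exp (z * Complex.I)) (Complex.exp (-z * Complex.I))]

open Metric in
/-- A holomorphic function on a disc omitting `±1` is the cosine of a holomorphic function whose
value at the centre is controlled. -/
theorem exists_differentiableOn_cos_eq {f : ℂ → ℂ} {c : ℂ} {r : ℝ} (hr : 0 < r)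
    (hf : DifferentiableOn ℂ f (ball c r)) (h1 : ∀ z ∈ ball c r, f z ≠ 1)
    (h2 : ∀ z ∈ ball c r, f z ≠ -1) :
    ∃ g : ℂ → ℂ, DifferentiableOn ℂ g (ball c r) ∧ (∀ z ∈ ball c r, Complex.cos (g z) = f z) ∧
      ‖g c‖ ≤ Real.pi + ‖f c‖ := by
  -- A root `s` of `f ^ 2 - 1` gives `(f + s) * (f - s) = 1`; hence `f + s` has a logarithm `m`, and
  -- `cos (-I * m) = f`.
  obtain ⟨l, hl, hle⟩ := exists_differentiableOn_exp_eq (f := fun z => f z ^ 2 - 1)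
    ((hf.pow 2).sub_const 1) (fun z hz h => by
      have : (f z - 1) * (f z + 1) = 0 := by linear_combination h
      rcases mul_eq_zero.1 this with h | h
      · exact h1 z hz (sub_eq_zero.1 h)
      · exact h2 z hz (eq_neg_of_add_eq_zero_left h))
  set s : ℂ → ℂ := fun z => Complex.exp (l z / 2) with hs
  have hsd : DifferentiableOn ℂ s (ball c r) := (hl.div_const 2).cexp
  have hs2 : ∀ z ∈ ball c r, s z ^ 2 = f z ^ 2 - 1 := fun z hz => by
    rw [← hle z hz, hs, ← Complex.exp_nat_mul]; congr 1; push_cast; ring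
  obtain ⟨m, hm, hme⟩ := exists_differentiableOn_exp_eq (f := fun z => f z + s z) (hf.add hsd)
    (fun z hz h => by
      have h3 := hs2 z hz
      have h4 : s z = -f z := eq_neg_of_add_eq_zero_right h
      rw [h4] at h3
      have : (1 : ℂ) = 0 := by linear_combination h3
      exact one_ne_zero this)
  have hcos : ∀ z ∈ ball c r, Complex.cos (-Complex.I * m z) = f z := by
    intro z hz
    have e1 : -Complex.I * m z * Complex.I = m z := by
      linear_combination -m z * Complex.I_mul_I
    have e2 : -(-Complex.I * m z) * Complex.I = -m z := by
      linear_combination m z * Complex.I_mul_I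
    have hne : f z + s z ≠ 0 := by rw [← hme z hz]; exact Complex.exp_ne_zero _
    rw [Complex.cos, e1, e2, Complex.exp_neg, hme z hz]
    field_simp
    linear_combination hs2 z hz
  have hcc : c ∈ ball c r := mem_ball_self hr
  obtain ⟨v, hv, hvn⟩ := exists_cos_eq_and_norm_le (f c)
  have hmd : DifferentiableOn ℂ (fun z => -Complex.I * m z) (ball c r) := hm.const_mul _
  -- Inverse cosines differ by sign and multiples of `2π`, so the branch can be moved to take the
  -- small value `v` at `c`.
  obtain ⟨k, hk | hk⟩ := Complex.cos_eq_cos_iff.1 ((hcos c hcc).trans hv.symm)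
  · refine ⟨fun z => -Complex.I * m z + k * (2 * Real.pi), hmd.add_const _, fun z hz => ?_, ?_⟩
    · rw [Complex.cos_add_int_mul_two_pi, hcos z hz]
    · convert hvn using 2
      rw [hk]; ring
  · refine ⟨fun z => k * (2 * Real.pi) - -Complex.I * m z, hmd.const_sub _, fun z hz => ?_, ?_⟩
    · rw [Complex.cos_int_mul_two_pi_sub, hcos z hz]
    · convert hvn using 2
      rw [hk]; ring

/-! ### Schottky's theorem -/

theorem Complex.cos_add_int_mul_pi (z : ℂ) (n : ℤ) :
    Complex.cos (z + n * Real.pi) = (-1) ^ n * Complex.cos z :=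
  n.cast_negOnePow ℂ ▸ Complex.cos_antiperiodic.add_int_mul_eq n

/-- The points `m π + i y` with `cosh y` a natural number form a net in the plane. -/
theorem exists_dist_lt_four_of_cosh_eq_natCast (w : ℂ) :
    ∃ (m : ℤ) (n : ℕ) (y : ℝ), Real.cosh y = n ∧
      dist ((m * Real.pi : ℂ) + y * Complex.I) w < 4 := by
  have him : ∃ (n : ℕ) (y : ℝ), Real.cosh y = n ∧ |y - w.im| < 2 := by
    have hpos : ∀ Y : ℝ, 0 ≤ Y → ∃ (n : ℕ) (y : ℝ), Real.cosh y = n ∧ |y - Y| < 2 := by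
      intro Y hY
      have hc1 := Real.one_le_cosh Y
      -- `cosh` gains at least 1 over length `3 / 2`, so it meets a natural number there.
      have hgap : Real.cosh Y + 1 ≤ Real.cosh (Y + 3 / 2) := by
        rw [Real.cosh_add]
        have h1 : (2:ℝ) ≤ Real.cosh (3 / 2) := by
          have h2 := Real.cosh_sq (3 / 4 : ℝ)
          have h3 : (3/4:ℝ) ≤ Real.sinh (3 / 4) := Real.self_le_sinh_iff.2 (by norm_num)
          have h4 := Real.cosh_two_mul (3 / 4 : ℝ)
          norm_num at h4
          rw [h4]
          nlinarith
        have h2 : 0 ≤ Real.sinh Y := Real.sinh_nonneg_iff.2 hY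
        have h3 : 0 ≤ Real.sinh (3 / 2) := Real.sinh_nonneg_iff.2 (by norm_num)
        nlinarith [mul_nonneg h2 h3]
      have hle : ((⌈Real.cosh Y⌉₊ : ℕ) : ℝ) ∈ Icc (Real.cosh Y) (Real.cosh (Y + 3 / 2)) :=
        ⟨Nat.le_ceil _, (Nat.ceil_lt_add_one (by linarith)).le.trans hgap⟩
      obtain ⟨y, hy, hyn⟩ := intermediate_value_Icc (by linarith : Y ≤ Y + 3 / 2)
        Real.continuous_cosh.continuousOn hle
      refine ⟨⌈Real.cosh Y⌉₊, y, hyn, ?_⟩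
      rw [abs_lt]; constructor <;> linarith [hy.1, hy.2]
    rcases le_total 0 w.im with h | h
    · exact hpos _ h
    · obtain ⟨n, y, hy, hd⟩ := hpos (-w.im) (by linarith)
      refine ⟨n, -y, by rwa [Real.cosh_neg], ?_⟩
      rw [← abs_neg]; convert hd using 2; ring
  obtain ⟨n, y, hy, hd⟩ := him
  refine ⟨round (w.re / Real.pi), n, y, hy, ?_⟩
  rw [dist_eq_norm]
  refine (Complex.norm_le_abs_re_add_abs_im _).trans_lt ?_
  have hre : |(round (w.re / Real.pi) : ℝ) * Real.pi - w.re| < 2 := by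
    have h1 := abs_sub_round (w.re / Real.pi)
    have h2 : (round (w.re / Real.pi) : ℝ) * Real.pi - w.re =
        -((w.re / Real.pi - round (w.re / Real.pi)) * Real.pi) := by
      field_simp; ring
    rw [h2, abs_neg, abs_mul, abs_of_pos Real.pi_pos]
    nlinarith [Real.pi_lt_four, Real.pi_pos]
  simp
  linarith

open Metric in
/-- **Schottky's theorem** for holomorphic functions omitting `1` and `-1`. -/
theorem schottky_one_neg_one (R : ℝ) : ∃ M : ℝ, ∀ (f : ℂ → ℂ) (c : ℂ) (r : ℝ), 0 < r →
    DifferentiableOn ℂ f (ball c r) → (∀ z ∈ ball c r, f z ≠ 1) → (∀ z ∈ ball c r, f z ≠ -1) →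
    ‖f c‖ ≤ R → ∀ z ∈ ball c (r / 2), ‖f z‖ ≤ M := by
  refine ⟨Real.exp (Real.pi * Real.exp (Real.pi + (Real.pi + R) + 512)),
    fun f c r hr hf h1 h2 hR z hz => ?_⟩
  have hpi := Real.pi_pos
  have hpi1 : 1 ≤ Real.pi := by linarith [Real.pi_gt_three]
  have hpiC : (Real.pi : ℂ) ≠ 0 := by exact_mod_cast hpi.ne'
  have hcc : c ∈ ball c r := mem_ball_self hr
  obtain ⟨F, hF, hFf, hFc⟩ := exists_differentiableOn_cos_eq hr hf h1 h2
  have hF' : ∀ z ∈ ball c r, ∀ n : ℤ, F z / Real.pi ≠ n := by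
    intro z hz n hn
    rw [div_eq_iff hpiC] at hn
    have h := hFf z hz
    rw [hn, ← zero_add ((n : ℂ) * _), Complex.cos_add_int_mul_pi, Complex.cos_zero, mul_one] at h
    rcases Int.even_or_odd n with h' | h' <;> rw [h'.neg_one_zpow] at h
    · exact h1 z hz h.symm
    · exact h2 z hz h.symm
  obtain ⟨G, hG, hGF, hGc⟩ := exists_differentiableOn_cos_eq hr (hF.div_const (Real.pi : ℂ))
    (fun z hz => by exact_mod_cast hF' z hz 1) (fun z hz => by exact_mod_cast hF' z hz (-1))
  -- At a net point `cos G = ± n`, which would make `F / π` an integer and `f = ± 1`.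
  have homit : ∀ w, ¬ ball w 4 ⊆ G '' ball c r := by
    intro w hw
    obtain ⟨m, n, y, hy, hd⟩ := exists_dist_lt_four_of_cosh_eq_natCast w
    obtain ⟨x, hx, hxG⟩ := hw hd
    have h := hGF x hx
    rw [hxG, add_comm, Complex.cos_add_int_mul_pi, Complex.cos_mul_I, ← Complex.ofReal_cosh, hy] at h
    rcases Int.even_or_odd m with h' | h' <;> rw [h'.neg_one_zpow] at h
    · exact hF' x hx n (by rw [← h]; simp)
    · exact hF' x hx (-n) (by rw [← h]; simp)
  -- Bloch's theorem on a disc of radius `r / 2` with `B = 4`: `128 * 4 / (r / 2) = 1024 / r`.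
  have hderiv : ∀ x ∈ ball c (r / 2), ‖deriv G x‖ ≤ 1024 / r := by
    intro x hx
    have hsub : ball x (r / 2) ⊆ ball c r := ball_subset_ball' (by
      have : dist x c < r / 2 := hx
      linarith)
    have := norm_deriv_mul_le_of_forall_not_ball_subset_image (B := 4) (half_pos hr) (by norm_num)
      (hG.mono hsub) (fun w hw => homit w (hw.trans (image_mono hsub)))
    rw [le_div_iff₀ hr]
    linarith
  have hsub : ball c (r / 2) ⊆ ball c r := ball_subset_ball (by linarith)
  have hGz : ‖G z - G c‖ ≤ 512 := by
    refine ((convex_ball c (r / 2)).norm_image_sub_le_of_norm_deriv_le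
      (fun x hx => hG.differentiableAt (isOpen_ball.mem_nhds (hsub hx))) hderiv
      (mem_ball_self (by linarith)) hz).trans ?_
    have : ‖z - c‖ < r / 2 := by rw [← dist_eq_norm]; exact hz
    calc 1024 / r * ‖z - c‖ ≤ 1024 / r * (r / 2) := by gcongr
      _ = 512 := by field_simp; norm_num
  have hFcd : ‖F c / Real.pi‖ ≤ Real.pi + R := by
    rw [norm_div, Complex.norm_real, Real.norm_of_nonneg hpi.le]
    exact (div_le_self (norm_nonneg _) hpi1).trans (hFc.trans (by linarith))
  have hGn : ‖G z‖ ≤ Real.pi + (Real.pi + R) + 512 := by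
    have := norm_add_le (G z - G c) (G c)
    rw [sub_add_cancel] at this
    linarith
  have hFz : ‖F z‖ ≤ Real.pi * Real.exp (Real.pi + (Real.pi + R) + 512) := by
    have h : F z = Real.pi * Complex.cos (G z) := by
      rw [hGF z (hsub hz)]; field_simp
    rw [h, norm_mul, Complex.norm_real, Real.norm_of_nonneg hpi.le]
    gcongr
    exact (Complex.norm_cos_le_exp_norm _).trans (Real.exp_le_exp.2 hGn)
  rw [← hFf z (hsub hz)]
  exact (Complex.norm_cos_le_exp_norm _).trans (Real.exp_le_exp.2 hFz)

open Metric in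
/-- **Schottky's theorem** for holomorphic functions omitting two distinct values. -/
theorem schottky {a b : ℂ} (hab : a ≠ b) (R : ℝ) : ∃ M : ℝ, ∀ (f : ℂ → ℂ) (c : ℂ) (r : ℝ), 0 < r →
    f ∈ HolMaps (ball c r) {a, b}ᶜ → ‖f c‖ ≤ R → ∀ z ∈ ball c (r / 2), ‖f z‖ ≤ M := by
  have hba : b - a ≠ 0 := sub_ne_zero.2 hab.symm
  obtain ⟨M, hM⟩ := schottky_one_neg_one ((2 * R + ‖a + b‖) / ‖b - a‖)
  refine ⟨(‖b - a‖ * M + ‖a + b‖) / 2, fun f c r hr hf hR z hz => ?_⟩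
  have hne : ∀ z ∈ ball c r, f z ≠ a ∧ f z ≠ b := fun z hz => by simpa using hf.2 hz
  -- The affine map taking `a` to `-1` and `b` to `1`.
  have h := hM (fun z => (2 * f z - (a + b)) / (b - a)) c r hr
    (((hf.1.const_mul 2).sub_const _).div_const _)
    (fun z hz h => (hne z hz).2 (by
      rw [div_eq_iff hba] at h
      linear_combination h / 2))
    (fun z hz h => (hne z hz).1 (by
      rw [div_eq_iff hba] at h
      linear_combination h / 2))
    (by
      rw [norm_div]
      gcongr
      refine (norm_sub_le _ _).trans ?_
      rw [norm_mul, Complex.norm_ofNat]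
      gcongr) z hz
  have h2 : f z = ((b - a) * ((2 * f z - (a + b)) / (b - a)) + (a + b)) / 2 := by
    field_simp; ring
  rw [h2, norm_div, Complex.norm_ofNat]
  gcongr
  refine (norm_add_le _ _).trans ?_
  rw [norm_mul]
  gcongr

/-! ### Local boundedness and Montel's theorem -/

theorem HolMaps.mono {Ω₁ Ω₁' Ω₂ : Set ℂ} (h : Ω₁' ⊆ Ω₁) : HolMaps Ω₁ Ω₂ ⊆ HolMaps Ω₁' Ω₂ :=
  fun _ hf => ⟨hf.1.mono h, hf.2.mono_left h⟩

open Metric in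
/-- A family of holomorphic functions omitting two values and bounded at one point of a domain is
locally uniformly bounded. -/
theorem locally_bounded_of_omits_two {ι : Type*} {a b : ℂ} (hab : a ≠ b) {Ω : Set ℂ}
    (hΩ : IsOpen Ω) (hconn : IsPreconnected Ω) {f : ι → ℂ → ℂ} (hf : ∀ n, f n ∈ HolMaps Ω {a, b}ᶜ)
    {z₀ : ℂ} (hz₀ : z₀ ∈ Ω) {R : ℝ} (hR : ∀ n, ‖f n z₀‖ ≤ R) :
    ∀ z ∈ Ω, ∃ ρ > 0, ∃ M, ball z ρ ⊆ Ω ∧ ∀ n, ∀ w ∈ ball z ρ, ‖f n w‖ ≤ M := by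
  have hloc : ∀ z r R, 0 < r → ball z r ⊆ Ω → (∀ n, ‖f n z‖ ≤ R) →
      ∃ M, ∀ n, ∀ w ∈ ball z (r / 2), ‖f n w‖ ≤ M := by
    intro z r R hr hsub hR
    obtain ⟨M, hM⟩ := schottky hab R
    exact ⟨M, fun n => hM (f n) z r hr (HolMaps.mono hsub (hf n)) (hR n)⟩
  -- By Schottky's theorem, this set of pointwise boundedness is open and relatively closed in `Ω`.
  set u : Set ℂ := {z | z ∈ Ω ∧ ∃ M, ∀ n, ‖f n z‖ ≤ M} with hu
  have huo : IsOpen u := by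
    rw [Metric.isOpen_iff]
    rintro z ⟨hz, M, hM⟩
    obtain ⟨r, hr, hsub⟩ := Metric.isOpen_iff.1 hΩ z hz
    obtain ⟨M', hM'⟩ := hloc z r M hr hsub hM
    exact ⟨r / 2, by positivity, fun w hw => ⟨hsub (ball_subset_ball (by linarith) hw), M',
      fun n => hM' n w hw⟩⟩
  have hsub : Ω ⊆ u := by
    refine hconn.subset_of_closure_inter_subset huo ⟨z₀, hz₀, hz₀, R, hR⟩ ?_
    rintro z ⟨hzu, hz⟩
    obtain ⟨r, hr, hsub⟩ := Metric.isOpen_iff.1 hΩ z hz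
    obtain ⟨w, ⟨-, M, hM⟩, hzw⟩ := Metric.mem_closure_iff.1 hzu (r / 4) (by positivity)
    obtain ⟨M', hM'⟩ := hloc w (r / 2) M (by positivity)
      ((ball_subset_ball' (by rw [dist_comm]; linarith)).trans hsub) hM
    exact ⟨hz, M', fun n => hM' n z (by rw [mem_ball]; linarith)⟩
  intro z hz
  obtain ⟨-, M, hM⟩ := hsub hz
  obtain ⟨r, hr, hsub⟩ := Metric.isOpen_iff.1 hΩ z hz
  obtain ⟨M', hM'⟩ := hloc z r M hr hsub hM
  exact ⟨r / 2, by positivity, M', (ball_subset_ball (by linarith)).trans hsub, hM'⟩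

open Metric in
/-- A locally uniformly bounded family of holomorphic functions is equicontinuous. -/
theorem equicontinuousAt_of_norm_le {ι : Type*} {f : ι → ℂ → ℂ} {z : ℂ} {ρ M : ℝ} (hρ : 0 < ρ)
    (hf : ∀ n, DifferentiableOn ℂ (f n) (ball z ρ)) (hM : ∀ n, ∀ w ∈ ball z ρ, ‖f n w‖ ≤ M) :
    EquicontinuousAt f z := by
  rw [Metric.equicontinuousAt_iff_right]
  intro ε hε
  have hlim : Tendsto (fun w => 2 * M / ρ * dist w z) (𝓝 z) (𝓝 0) := by
    have : Continuous fun w => 2 * M / ρ * dist w z := by fun_prop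
    simpa using this.tendsto z
  filter_upwards [ball_mem_nhds z hρ, hlim.eventually_lt_const hε] with w hw hlt n
  rw [dist_comm]
  refine (Complex.dist_le_div_mul_dist_of_mapsTo_ball (hf n) (fun x hx => ?_) hw).trans_lt hlt
  rw [mem_closedBall, dist_eq_norm]
  have := hM n x hx
  have := hM n z (mem_ball_self hρ)
  linarith [norm_sub_le (f n x) (f n z)]

/-- A pointwise bounded sequence of functions on a countable set has a pointwise convergent
subsequence. -/
theorem Set.Countable.exists_strictMono_tendsto {D : Set ℂ} (hD : D.Countable) {f : ℕ → ℂ → ℂ}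
    (hb : ∀ z ∈ D, ∃ M, ∀ n, ‖f n z‖ ≤ M) :
    ∃ φ : ℕ → ℕ, StrictMono φ ∧ ∀ z ∈ D, ∃ l, Tendsto (fun n => f (φ n) z) atTop (𝓝 l) := by
  have := hD.to_subtype
  choose! M hM using hb
  obtain ⟨l, -, φ, hφ, hl⟩ := (isCompact_univ_pi fun d : D =>
    isCompact_closedBall (0 : ℂ) (M d)).tendsto_subseq (x := fun n (d : D) => f n d)
    (fun n d _ => mem_closedBall_zero_iff.2 (hM d d.2 n))
  exact ⟨φ, hφ, fun z hz => ⟨l ⟨z, hz⟩, tendsto_pi_nhds.1 hl ⟨z, hz⟩⟩⟩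

open Metric in
/-- **Montel's theorem**: a locally uniformly bounded sequence of holomorphic functions has a
subsequence converging uniformly on compact sets to a holomorphic function. -/
theorem exists_strictMono_convergesOnCompacts {Ω : Set ℂ} (hΩ : IsOpen Ω) {f : ℕ → ℂ → ℂ}
    (hf : ∀ n, DifferentiableOn ℂ (f n) Ω)
    (hb : ∀ z ∈ Ω, ∃ ρ > 0, ∃ M, ball z ρ ⊆ Ω ∧ ∀ n, ∀ w ∈ ball z ρ, ‖f n w‖ ≤ M) :
    ∃ φ : ℕ → ℕ, StrictMono φ ∧ ∃ g : ℂ → ℂ, ConvergesOnCompacts Ω (fun n => f (φ n)) g := by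
  have hequi : ∀ z ∈ Ω, EquicontinuousAt f z := by
    intro z hz
    obtain ⟨ρ, hρ, M, hsub, hM⟩ := hb z hz
    exact equicontinuousAt_of_norm_le hρ (fun n => (hf n).mono hsub) hM
  obtain ⟨D, hD, hDd⟩ := TopologicalSpace.exists_countable_dense ℂ
  obtain ⟨φ, hφ, hl⟩ := (hD.mono inter_subset_right : (Ω ∩ D).Countable).exists_strictMono_tendsto
    (f := f) (fun z hz => by
      obtain ⟨ρ, hρ, M, -, hM⟩ := hb z hz.1
      exact ⟨M, fun n => hM n z (mem_ball_self hρ)⟩)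
  have hequi' : ∀ z ∈ Ω, EquicontinuousAt (fun n => f (φ n)) z := fun z hz => (hequi z hz).comp φ
  have hconv : ∀ z ∈ Ω, ∃ l, Tendsto (fun n => f (φ n) z) atTop (𝓝 l) := by
    intro z hz
    refine cauchySeq_tendsto_of_complete (Metric.cauchySeq_iff.2 fun ε hε => ?_)
    have h1 := Metric.equicontinuousAt_iff_right.1 (hequi' z hz) (ε / 3) (by positivity)
    obtain ⟨y, hy, hyD⟩ := mem_closure_iff_nhds.1 (hDd.open_subset_closure_inter hΩ hz) _ h1
    obtain ⟨l, hl⟩ := hl y hyD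
    obtain ⟨N, hN⟩ := Metric.cauchySeq_iff.1 hl.cauchySeq (ε / 3) (by positivity)
    refine ⟨N, fun m hm n hn => ?_⟩
    have h2 := hN m hm n hn
    have h3 : dist (f (φ m) z) (f (φ m) y) < ε / 3 := hy m
    have h4 : dist (f (φ n) z) (f (φ n) y) < ε / 3 := hy n
    have := dist_triangle4_right (f (φ m) z) (f (φ n) z) (f (φ m) y) (f (φ n) y)
    linarith
  choose! g hg using hconv
  refine ⟨φ, hφ, g, ?_⟩
  let S : Set (Set ℂ) := {K | IsCompact K ∧ K ⊆ Ω}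
  -- Ascoli: equicontinuity upgrades pointwise convergence to uniform convergence on compacts.
  have key := (EquicontinuousOn.tendsto_uniformOnFun_iff_pi' (𝔖 := S) (fun K hK => hK.1)
    (F := fun n => f (φ n))
    (fun K hK z hz => (hequi' z (hK.2 hz)).equicontinuousWithinAt K) atTop g).2
    (tendsto_pi_nhds.2 fun x => by
      obtain ⟨K, hK, hx⟩ := x.2
      exact hg x (hK.2 hx))
  intro K hK hKΩ
  exact UniformOnFun.tendsto_iff_tendstoUniformlyOn.1 key K ⟨hK, hKΩ⟩

/-! ### Holomorphy of limits and Hurwitz's theorem -/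

theorem ConvergesOnCompacts.differentiableOn {Ω : Set ℂ} (hΩ : IsOpen Ω) {f : ℕ → ℂ → ℂ}
    {g : ℂ → ℂ} (h : ConvergesOnCompacts Ω f g) (hf : ∀ n, DifferentiableOn ℂ (f n) Ω) :
    DifferentiableOn ℂ g Ω :=
  TendstoLocallyUniformlyOn.differentiableOn
    ((tendstoLocallyUniformlyOn_iff_forall_isCompact hΩ).2 fun K hK hc => h K hc hK)
    (Eventually.of_forall hf) hΩ

open Metric in
/-- **Hurwitz's theorem**: if holomorphic functions omitting the value `a` converge uniformly on
compact subsets of a domain, then the limit omits `a` or is constantly equal to `a`. -/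
theorem ConvergesOnCompacts.forall_ne_or_forall_eq {Ω : Set ℂ} (hΩ : IsOpen Ω)
    (hconn : IsPreconnected Ω) {f : ℕ → ℂ → ℂ} {g : ℂ → ℂ} (h : ConvergesOnCompacts Ω f g)
    (hf : ∀ n, DifferentiableOn ℂ (f n) Ω) {a : ℂ} (ha : ∀ n, ∀ z ∈ Ω, f n z ≠ a) :
    (∀ z ∈ Ω, g z ≠ a) ∨ ∀ z ∈ Ω, g z = a := by
  by_contra! hcon
  obtain ⟨⟨z₀, hz₀, hgz₀⟩, z₁, hz₁, hgz₁⟩ := hcon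
  have hg := h.differentiableOn hΩ hf
  have hev : ∀ᶠ z in 𝓝[≠] z₀, g z ≠ a := by
    by_contra hev
    exact hgz₁ ((hg.analyticOnNhd hΩ).eqOn_of_preconnected_of_frequently_eq analyticOnNhd_const
      hconn hz₀ hev hz₁)
  obtain ⟨ρ, hρ, hρs⟩ := Metric.eventually_nhds_iff_ball.1
    ((eventually_nhdsWithin_iff.1 hev).and (hΩ.mem_nhds hz₀))
  have hcb : closedBall z₀ (ρ / 2) ⊆ Ω := fun z hz =>
    (hρs z (closedBall_subset_ball (by linarith) hz)).2
  have hsph : ∀ z ∈ sphere z₀ (ρ / 2), g z ≠ a := fun z hz =>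
    (hρs z (closedBall_subset_ball (by linarith) (sphere_subset_closedBall hz))).1
      (ne_of_mem_sphere hz (by positivity))
  obtain ⟨p, hp, hmin⟩ := (isCompact_sphere z₀ (ρ / 2)).exists_isMinOn
    (NormedSpace.sphere_nonempty.2 (by positivity))
    ((hg.continuousOn.mono (sphere_subset_closedBall.trans hcb)).sub
      (continuousOn_const (c := a))).norm
  set m := ‖g p - a‖ with hm
  have hm0 : 0 < m := norm_pos_iff.2 (sub_ne_zero.2 (hsph p hp))
  obtain ⟨n, hn⟩ := (Metric.tendstoUniformlyOn_iff.1 (h _ (isCompact_closedBall z₀ (ρ / 2)) hcb)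
    (m / 3) (by positivity)).exists
  have hinv : ∀ z ∈ closedBall z₀ (ρ / 2), f n z - a ≠ 0 := fun z hz =>
    sub_ne_zero.2 (ha n z (hcb hz))
  have hd : DiffContOnCl ℂ (fun z => (f n z - a)⁻¹) (ball z₀ (ρ / 2)) :=
    ((((hf n).mono hcb).sub_const a).inv hinv |>.mono closure_ball_subset_closedBall).diffContOnCl
  -- Maximum principle for `1 / (f n - a)`: `|f n - a|` is at least `2 m / 3` on the circle but
  -- below `m / 3` at the centre.
  have hbd := Complex.norm_le_of_forall_mem_frontier_norm_le isBounded_ball hd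
    (C := (2 * m / 3)⁻¹) (fun z hz => by
      rw [frontier_ball _ (by positivity)] at hz
      have h1 := hn z (sphere_subset_closedBall hz)
      have h2 : m ≤ ‖g z - a‖ := hmin hz
      rw [dist_eq_norm] at h1
      have h3 := norm_add_le (g z - f n z) (f n z - a)
      rw [sub_add_sub_cancel] at h3
      rw [norm_inv]
      gcongr
      linarith) (subset_closure (mem_ball_self (by positivity : 0 < ρ / 2)))
  rw [norm_inv, inv_le_inv₀ (norm_pos_iff.2 (hinv z₀ (mem_closedBall_self (by positivity))))
    (by positivity)] at hbd
  have h1 := hn z₀ (mem_closedBall_self (by positivity))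
  rw [dist_comm, dist_eq_norm, hgz₀] at h1
  linarith

/-! ### The normality theorem -/

theorem mainTheorem6 (a b : ℂ) (hab : a ≠ b) (Ω : Set ℂ) (hΩ : IsOpen Ω) (hconn : IsConnected Ω)
    (F : Set (ℂ → ℂ)) (hF : F ⊆ HolMaps Ω ({a, b}ᶜ : Set ℂ)) :
    IsNormalFamily Ω ({a, b}ᶜ : Set ℂ) F := by
  intro f hfF
  have hf : ∀ n, f n ∈ HolMaps Ω {a, b}ᶜ := fun n => hF (hfF n)
  refine or_iff_not_imp_right.2 fun hdiv => ?_
  unfold CompactlyDivergent at hdiv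
  push Not at hdiv
  obtain ⟨K, L, hK, hKΩ, hL, hLab, hKL⟩ := hdiv
  obtain ⟨φ, hφ, hφKL⟩ := extraction_of_frequently_atTop
    (frequently_atTop'.2 fun N => by
      obtain ⟨n, hn, h⟩ := hKL N
      exact ⟨n, hn, h⟩ : ∃ᶠ n in atTop, (f n '' K ∩ L).Nonempty)
  have hex : ∀ n, ∃ z ∈ K, f (φ n) z ∈ L := fun n => by
    obtain ⟨_, ⟨z, hz, rfl⟩, hzL⟩ := hφKL n
    exact ⟨z, hz, hzL⟩
  choose z hzK hzL using hex
  obtain ⟨z₀, hz₀K, ψ, hψ, hψz⟩ := hK.tendsto_subseq hzK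
  have hz₀ : z₀ ∈ Ω := hKΩ hz₀K
  obtain ⟨r, hr, hrΩ⟩ := Metric.isOpen_iff.1 hΩ z₀ hz₀
  obtain ⟨N, hN⟩ := eventually_atTop.1
    (hψz.eventually (Metric.ball_mem_nhds z₀ (show 0 < r / 4 by positivity)))
  obtain ⟨R, hR⟩ := hL.isBounded.exists_norm_le
  obtain ⟨M, hM⟩ := schottky hab R
  set χ : ℕ → ℕ := fun n => ψ (n + N) with hχ
  have hχm : StrictMono χ := hψ.comp (strictMono_id.add_const N)
  have hχz : Tendsto (fun n => z (χ n)) atTop (𝓝 z₀) := hψz.comp (tendsto_add_atTop_nat N)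
  -- Schottky's theorem is centred at the moving points `z (χ n)`; the tail starting at `N` keeps
  -- `z₀` within `r / 4` of them.
  have hbound : ∀ n, ‖f (φ (χ n)) z₀‖ ≤ M := by
    intro n
    have hd : dist (z (χ n)) z₀ < r / 4 := hN (n + N) (Nat.le_add_left _ _)
    refine hM _ (z (χ n)) (r / 2) (by positivity) (HolMaps.mono
      ((Metric.ball_subset_ball' (by linarith)).trans hrΩ) (hf _)) (hR _ (hzL _)) z₀ ?_
    rw [Metric.mem_ball, dist_comm]
    linarith
  obtain ⟨θ, hθ, g, hg⟩ := exists_strictMono_convergesOnCompacts hΩ (fun n => (hf (φ (χ n))).1)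
    (locally_bounded_of_omits_two hab hΩ hconn.isPreconnected (fun n => hf (φ (χ n))) hz₀ hbound)
  have hfd : ∀ n, DifferentiableOn ℂ (f (φ (χ (θ n)))) Ω := fun n => (hf _).1
  have hgd : DifferentiableOn ℂ g Ω := hg.differentiableOn hΩ hfd
  have hlim : Tendsto (fun n => f (φ (χ (θ n))) (z (χ (θ n)))) atTop (𝓝 (g z₀)) :=
    (hg K hK hKΩ).tendsto_comp ((hgd.continuousOn.mono hKΩ) z₀ hz₀K)
      (tendsto_nhdsWithin_iff.2 ⟨hχz.comp hθ.tendsto_atTop, Eventually.of_forall fun n => hzK _⟩)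
  have hgL : g z₀ ∈ L := hL.isClosed.mem_of_tendsto hlim (Eventually.of_forall fun n => hzL _)
  have hgz₀ : g z₀ ≠ a ∧ g z₀ ≠ b := by simpa using hLab hgL
  have hne : ∀ n, ∀ w ∈ Ω, f (φ (χ (θ n))) w ≠ a ∧ f (φ (χ (θ n))) w ≠ b := fun n w hw => by
    simpa using (hf (φ (χ (θ n)))).2 hw
  have hga := (hg.forall_ne_or_forall_eq hΩ hconn.isPreconnected hfd
    fun n w hw => (hne n w hw).1).resolve_right fun h => hgz₀.1 (h z₀ hz₀)
  have hgb := (hg.forall_ne_or_forall_eq hΩ hconn.isPreconnected hfd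
    fun n w hw => (hne n w hw).2).resolve_right fun h => hgz₀.2 (h z₀ hz₀)
  exact ⟨fun n => φ (χ (θ n)), hφ.comp (hχm.comp hθ), g,
    ⟨hgd, fun w hw => by simpa using ⟨hga w hw, hgb w hw⟩⟩, hg⟩
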